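/- Let $p$ be a prime. For a finitely generated pro-$p$ group $G$ let $\Omega(G)=\varprojlim_U\mathbb{F}_p[G/U]$ ($U$ running over the open normal subgroups of $G$) be its mod-$p$ Iwasawa algebra, $I_G$ the augmentation ideal of $\Omega(G)$, $c_n(G)=\dim_{\mathbb{F}_p}(I_G^n/I_G^{n+1})$ for $n\ge 0$ (with $I_G^0=\Omega(G)$, so that $c_0(G)=1$), and $\rho(G)=\limsup_{n\to\infty}c_n(G)^{1/n}\in[0,\infty]$. The depth of $x\in G$ is $\omega_G(x)=\max\{n : x-1\in I_G^n\}$ for $x\neq 1$, and $\omega_G(1)=\infty$. Now let $G$ be a finitely presented pro-$p$ group, and let $d=\dim_{\mathbb{F}_p}H^1(G,\mathbb{F}_p)$ and $r=\dim_{\mathbb{F}_p}H^2(G,\mathbb{F}_p)$ (continuous cohomology, trivial action). Let $1\to R\to F\xrightarrow{\varphi}G\to 1$ be a minimal presentation of $G$, i.e. $F$ is a free pro-$p$ group on $d$ generators, $\varphi$ is a continuous surjective homomorphism, and $R=\ker\varphi$ is generated, as a closed normal subgroup of $F$, by $r$ elements $\rho_1,\dots,\rho_r$. Let $$P(G;t)=1-dt+\sum_{i=1}^{r}t^{\omega_F(\rho_i)}$$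 be the associated Golod–Shafarevich polynomial (with the convention $t^\infty=0$). If $P(G;t_0)<0$ for some $t_0\in(0,1)$, then $\rho(G)\ge \dfrac{1}{t_0}$. -/

import Mathlib

open scoped ENNReal

noncomputable section

namespace ProP

universe u

/-- `G` is a pro-`p` group: a profinite group (a compact, totally disconnected topological group)
all of whose open normal subgroups have index a power of `p`. -/
structure IsProP (p : ℕ) (G : Type*) [Group G] [TopologicalSpace G] [IsTopologicalGroup G] :
    Prop where
  compactSpace : CompactSpace G
  totallyDisconnectedSpace : TotallyDisconnectedSpace G
  index_eq : ∀ U : OpenNormalSubgroup G, ∃ k : ℕ, U.toSubgroup.index = p ^ k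

/-- `F` is a free pro-`p` group on the family `σ : Fin d → F`: it is pro-`p`, and every map from
the family to a finite (discrete) `p`-group extends uniquely to a continuous homomorphism on `F`.
As pro-`p` groups are the inverse limits of finite `p`-groups, this amounts to the universal
property for maps to arbitrary pro-`p` groups (and a finite group is isomorphic to one in
`Type`). -/
structure IsFreeProP (p : ℕ) {F : Type*} [Group F] [TopologicalSpace F] [IsTopologicalGroup F]
    {d : ℕ} (σ : Fin d → F) : Prop where
  isProP : IsProP p F
  existsUnique_lift : ∀ (H : Type) [Group H] [Finite H] [TopologicalSpace H] [DiscreteTopology H],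
    IsPGroup p H → ∀ f : Fin d → H, ∃! ψ : F →ₜ* H, ∀ i, ψ (σ i) = f i

/-- The natural map `𝔽_p[G/U] → 𝔽_p[G/V]` for open normal subgroups `U ≤ V`. -/
def transition (p : ℕ) {G : Type*} [Group G] [TopologicalSpace G] {U V : OpenNormalSubgroup G}
    (h : U ≤ V) :
    MonoidAlgebra (ZMod p) (G ⧸ U.toSubgroup) →ₐ[ZMod p]
      MonoidAlgebra (ZMod p) (G ⧸ V.toSubgroup) :=
  MonoidAlgebra.mapDomainAlgHom (ZMod p) (ZMod p)
    (QuotientGroup.map U.toSubgroup V.toSubgroup (MonoidHom.id G) h)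

/-- The mod-`p` Iwasawa algebra `Ω(G) = lim_U 𝔽_p[G/U]`, realized as the algebra of compatible
families in the product of the group algebras `𝔽_p[G/U]`, `U` open normal in `G`. -/
def iwasawaAlgebra (p : ℕ) (G : Type*) [Group G] [TopologicalSpace G] :
    Subalgebra (ZMod p) (∀ U : OpenNormalSubgroup G, MonoidAlgebra (ZMod p) (G ⧸ U.toSubgroup)) where
  carrier := {x | ∀ (U V : OpenNormalSubgroup G) (h : U ≤ V), transition p h (x U) = x V}
  mul_mem' hx hy U V h := by simp [hx U V h, hy U V h]
  add_mem' hx hy U V h := by simp [hx U V h, hy U V h]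
  algebraMap_mem' r U V h := by
    rw [Pi.algebraMap_apply, Pi.algebraMap_apply, AlgHom.commutes]

/-- The canonical map `ι : G → Ω(G)`, whose component at `U` is the class `gU ∈ 𝔽_p[G/U]`. -/
def iota (p : ℕ) {G : Type*} [Group G] [TopologicalSpace G] (g : G) : iwasawaAlgebra p G :=
  ⟨fun U => MonoidAlgebra.of (ZMod p) (G ⧸ U.toSubgroup) (QuotientGroup.mk g), fun U V h => by
    simp only [transition, MonoidAlgebra.of_apply, MonoidAlgebra.mapDomainAlgHom_apply,
      MonoidAlgebra.mapDomain_single]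
    rfl⟩

/-- The whole group, as an open normal subgroup. -/
def topOpenNormal (G : Type*) [Group G] [TopologicalSpace G] : OpenNormalSubgroup G where
  toOpenSubgroup := ⊤
  isNormal' := inferInstanceAs (⊤ : Subgroup G).Normal

/-- The augmentation map `α : Ω(G) → 𝔽_p`, which sends each `ι(g)` to `1`: the sum of the
coefficients of the component in `𝔽_p[G/G]` (equivalently, of any other component). -/
def augmentation (p : ℕ) (G : Type*) [Group G] [TopologicalSpace G] :
    iwasawaAlgebra p G →ₐ[ZMod p] ZMod p :=
  (MonoidAlgebra.lift (ZMod p) (ZMod p) (G ⧸ (topOpenNormal G).toSubgroup) 1).comp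
    ((Pi.evalAlgHom (ZMod p)
      (fun U : OpenNormalSubgroup G => MonoidAlgebra (ZMod p) (G ⧸ U.toSubgroup))
      (topOpenNormal G)).comp (iwasawaAlgebra p G).val)

theorem augmentation_iota (p : ℕ) {G : Type*} [Group G] [TopologicalSpace G] (g : G) :
    augmentation p G (iota p g) = 1 := by
  simp [augmentation, iota]

/-- The augmentation ideal `I_G` of `Ω(G)` (a two-sided ideal). -/
def augIdeal (p : ℕ) (G : Type*) [Group G] [TopologicalSpace G] : Ideal (iwasawaAlgebra p G) :=
  RingHom.ker (augmentation p G)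

/-- The power `I_G^n` of the augmentation ideal, as an `𝔽_p`-subspace of `Ω(G)`; `I_G^0 = Ω(G)`. -/
def augPow (p : ℕ) (G : Type*) [Group G] [TopologicalSpace G] (n : ℕ) :
    Submodule (ZMod p) (iwasawaAlgebra p G) :=
  (augIdeal p G ^ n).restrictScalars (ZMod p)

/-- `c_n(G) = dim_{𝔽_p} (I_G^n / I_G^{n+1})`; since `I_G^0 = Ω(G)`, `c_0(G) = 1`. -/
def hilbertCoeff (p : ℕ) (G : Type*) [Group G] [TopologicalSpace G] (n : ℕ) : ℕ :=
  Module.finrank (ZMod p)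
    (augPow p G n ⧸ (augPow p G (n + 1)).submoduleOf (augPow p G n))

/-- The exponential growth number `ρ(G) = limsup_n c_n(G)^{1/n}`, with values in `[0, ∞]`. -/
def rho (p : ℕ) (G : Type*) [Group G] [TopologicalSpace G] : ℝ≥0∞ :=
  Filter.limsup (fun n : ℕ => (hilbertCoeff p G n : ℝ≥0∞) ^ (1 / n : ℝ)) Filter.atTop

/-- The depth `ω_G(x) = max {n ∣ x - 1 ∈ I_G^n}`, with value `∞` at `x = 1`. -/
def depth (p : ℕ) {G : Type*} [Group G] [TopologicalSpace G] (x : G) : ℕ∞ :=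
  sSup {m : ℕ∞ | ∃ n : ℕ, m = n ∧ iota p x - 1 ∈ augPow p G n}

instance continuousSMul_ulift (p : ℕ) : ContinuousSMul (ZMod p) (ULift.{u} (ZMod p)) where
  continuous_smul := by
    have : DiscreteTopology (ULift.{u} (ZMod p)) := inferInstance
    exact continuous_of_discreteTopology

/-- The dimension over `𝔽_p` of the continuous cohomology group `H^n(G, 𝔽_p)`, where `G` acts
trivially on the discrete module `𝔽_p` (lifted to the universe of `G`). -/
def cohomologyDim (p : ℕ) (G : Type u) [Group G] [TopologicalSpace G] [IsTopologicalGroup G]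
    (n : ℕ) : Cardinal.{u} :=
  Module.rank (ZMod p)
    (continuousCohomology n
      (TopRep.of (ContRepresentation.trivial (ZMod p) G (ULift.{u} (ZMod p)))))

/-- `1 → R → F --φ--> G → 1` is a minimal presentation of `G` as a pro-`p` group: `F` is free pro-`p`
on `σ_1, …, σ_d` with `d = d(G) = dim H^1(G, 𝔽_p)`, and `R = ker φ` is generated, as a closed normal
subgroup of `F`, by `ρ_1, …, ρ_r` with `r = r(G) = dim H^2(G, 𝔽_p)`. -/
structure IsMinimalPresentation (p : ℕ) {F G : Type*}
    [Group F] [TopologicalSpace F] [IsTopologicalGroup F]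
    [Group G] [TopologicalSpace G] [IsTopologicalGroup G]
    {d r : ℕ} (σ : Fin d → F) (rel : Fin r → F) (φ : F →ₜ* G) : Prop where
  isFreeProP : IsFreeProP p σ
  surjective : Function.Surjective φ
  ker_eq : φ.toMonoidHom.ker = (Subgroup.normalClosure (Set.range rel)).topologicalClosure
  generators_eq : cohomologyDim p G 1 = d
  relators_eq : cohomologyDim p G 2 = r

/-- The Golod–Shafarevich polynomial `1 - d t + ∑ t ^ ω_F(ρ_i)` of a presentation with `d` generators
and relators `ρ_1, …, ρ_r` in `F`. A relator of infinite depth contributes `t ^ ∞ = 0`. -/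
def golodShafarevich (p : ℕ) {F : Type*} [Group F] [TopologicalSpace F] (d : ℕ) {r : ℕ}
    (rel : Fin r → F) : Polynomial ℝ :=
  1 - Polynomial.C (d : ℝ) * Polynomial.X +
    ∑ i, if depth p (rel i) = ⊤ then 0 else Polynomial.X ^ (depth p (rel i)).toNat

end ProP

end

/-! Let A be the free associative algebra on d letters over 𝔽_p, J_n the ideal spanned by words of
length at least n, and R the two-sided ideal generated by elements w_i ∈ J_{ω_i} with ω_i ≥ 1. Put
b_n = dim A/(R + J_n). Every element of R has the form ∑ w_i u_i + ∑ X_j κ_j with κ_j ∈ R, so the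
complex ⊕_i A/(R + J_{n+1-ω_i}) → (A/(R + J_n))^d → A/(R + J_{n+1}) → 𝔽_p is exact at the second
term. Counting dimensions gives d b_n + 1 ≤ b_{n+1} + ∑ b_{n+1-ω_i} (`golodShafarevich_recursion`).
Summed against t₀^{n+1}, with the polynomial nonpositive at t₀, this yields 1 ≤ d t₀^N b_N
(`one_le_mul_of_recursion`).

The w_i come from the Magnus map σ_j ↦ 1 + X_j into the finite p-group of principal units of
A/J_{N+1}: w_i lifts the image of ρ_i - 1 and can be taken in J_{ω_i}, where ω_i is the depth of
ρ_i. Modulo R the relators die, so the map descends to G and Ω(G)/I_G^{N+1} surjects onto A/(R +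
J_{N+1}). Hence b_{N+1} ≤ c_0(G) + ... + c_N(G) (`exists_relators_truncDim_le`,
`finrank_quotient_augPow`). The w_i depend on N, but the resulting bound on the partial sums does
not involve them. A limsup below 1/t₀ would make these sums O(s^N) with s < 1/t₀, a contradiction
(`ofReal_one_div_le_limsup`). -/

namespace ProP

/-! ### Dimension counts. -/

section LinearAlgebra

variable {k V : Type*} [Field k] [AddCommGroup V] [Module k V]

/-- V/Q is an image of k × (V/P)^d. This is the induction step for finiteness, used for the word
filtration and for the powers of the augmentation ideal. -/
theorem finiteDimensional_quotient_of_forall_eq_smul_add_sum {d : ℕ} (e : V)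
    (f : Fin d → V →ₗ[k] V) {P Q : Submodule k V} (hPQ : ∀ j, P ≤ Q.comap (f j))
    (hsurj : ∀ v, ∃ (c : k) (y : Fin d → V), v = c • e + ∑ j, f j (y j))
    [FiniteDimensional k (V ⧸ P)] : FiniteDimensional k (V ⧸ Q) := by
  let g : k × (Fin d → V ⧸ P) →ₗ[k] V ⧸ Q :=
    (LinearMap.toSpanSingleton k (V ⧸ Q) (Q.mkQ e)).coprod
      (LinearMap.lsum k (fun _ : Fin d => V ⧸ P) k fun j => P.mapQ Q (f j) (hPQ j))
  refine Module.Finite.of_surjective g fun q => ?_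
  obtain ⟨v, rfl⟩ := Q.mkQ_surjective q
  obtain ⟨c, y, rfl⟩ := hsurj v
  refine ⟨(c, fun j => P.mkQ (y j)), ?_⟩
  rw [map_add, map_sum, map_smul]
  simp [g]

theorem finrank_quotient_eq_add {P Q : Submodule k V} (h : P ≤ Q) [FiniteDimensional k (V ⧸ P)] :
    Module.finrank k (V ⧸ P) =
      Module.finrank k (V ⧸ Q) + Module.finrank k (Q ⧸ P.submoduleOf Q) := by
  have h1 := (P.mapQ Q LinearMap.id h).finrank_range_add_finrank_ker
  have hr : LinearMap.range (P.mapQ Q LinearMap.id h) = ⊤ := by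
    rw [LinearMap.range_eq_top]
    intro q
    obtain ⟨v, rfl⟩ := Q.mkQ_surjective q
    exact ⟨P.mkQ v, by simp⟩
  let g : (Q ⧸ P.submoduleOf Q) →ₗ[k] V ⧸ P := (P.submoduleOf Q).mapQ P Q.subtype le_rfl
  have hgm (v : Q) : g ((P.submoduleOf Q).mkQ v) = P.mkQ v := rfl
  have hg : Function.Injective g := by
    rw [injective_iff_map_eq_zero]
    intro x hx
    obtain ⟨v, rfl⟩ := Submodule.mkQ_surjective _ x
    rw [hgm, Submodule.mkQ_apply, Submodule.Quotient.mk_eq_zero] at hx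
    rw [Submodule.mkQ_apply, Submodule.Quotient.mk_eq_zero]
    exact hx
  have hk : LinearMap.ker (P.mapQ Q LinearMap.id h) = LinearMap.range g := by
    ext x
    obtain ⟨v, rfl⟩ := P.mkQ_surjective x
    simp only [Submodule.mkQ_apply, LinearMap.mem_ker, Submodule.mapQ_apply, LinearMap.id_apply,
      Submodule.Quotient.mk_eq_zero, LinearMap.mem_range]
    constructor
    · intro hv
      exact ⟨(P.submoduleOf Q).mkQ ⟨v, hv⟩, hgm ⟨v, hv⟩⟩
    · rintro ⟨y, hy⟩
      obtain ⟨w, rfl⟩ := Submodule.mkQ_surjective _ y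
      rw [hgm, Submodule.mkQ_apply, Submodule.Quotient.eq] at hy
      have := Q.sub_mem w.2 (h hy)
      simpa using this
  rw [hr, finrank_top, hk, LinearMap.finrank_range_of_inj hg] at h1
  exact h1.symm

/-- In C → A → B → k, exactness at A gives dim A ≤ dim C + rank β, and rank β ≤ dim B - 1 because
the image of β lies in the hyperplane ker ε. -/
theorem finrank_add_one_le_of_ker_le_range {A B C : Type*} [AddCommGroup A] [Module k A]
    [AddCommGroup B] [Module k B] [AddCommGroup C] [Module k C] [FiniteDimensional k A]
    [FiniteDimensional k B] [FiniteDimensional k C] (α : C →ₗ[k] A) (β : A →ₗ[k] B)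
    (ε : B →ₗ[k] k) (hαβ : LinearMap.ker β ≤ LinearMap.range α) (hβε : ε ∘ₗ β = 0) (hε : ε ≠ 0) :
    Module.finrank k A + 1 ≤ Module.finrank k B + Module.finrank k C := by
  have h1 := β.finrank_range_add_finrank_ker
  have h2 := ε.finrank_range_add_finrank_ker
  have h3 := Submodule.finrank_mono hαβ
  have h4 := α.finrank_range_le
  have h5 := Submodule.finrank_mono (LinearMap.range_le_ker_iff.mpr hβε)
  rw [LinearMap.range_eq_top.mpr (LinearMap.surjective hε), finrank_top,
    Module.finrank_self] at h2
  omega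

end LinearAlgebra

/-! ### From the recursion to exponential growth. -/

section Series

/-- The numerical core of the Golod–Shafarevich argument: summing the recursion against `t ^ n`
up to `N` bounds `b N` from below. -/
theorem one_le_mul_of_recursion {ι : Type*} [Fintype ι] (ω : ι → ℕ) (b : ℕ → ℕ) (d : ℕ) {t : ℝ}
    (ht : 0 < t) (hb : b 0 = 0)
    (hrec : ∀ n, d * b n + 1 ≤ b (n + 1) + ∑ i, b (n + 1 - ω i))
    (hneg : 1 - d * t + ∑ i, t ^ ω i ≤ 0) {N : ℕ} (hN : 1 ≤ N) :
    1 ≤ d * t ^ N * b N := by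
  set S : ℝ := ∑ n ∈ Finset.range (N + 1), b n * t ^ n with hS
  have hS0 : 0 ≤ S := Finset.sum_nonneg fun _ _ => by positivity
  have hsum : ∑ n ∈ Finset.range N, ((d : ℝ) * b n + 1) * t ^ (n + 1) ≤
      ∑ n ∈ Finset.range N, ((b (n + 1) : ℝ) + ∑ i, (b (n + 1 - ω i) : ℝ)) * t ^ (n + 1) := by
    refine Finset.sum_le_sum fun n _ => ?_
    have := hrec n
    have h' : (d : ℝ) * b n + 1 ≤ (b (n + 1) : ℝ) + ∑ i, (b (n + 1 - ω i) : ℝ) := by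
      exact_mod_cast this
    gcongr
  have hleft : (d : ℝ) * t * (S - b N * t ^ N) + t ≤
      ∑ n ∈ Finset.range N, ((d : ℝ) * b n + 1) * t ^ (n + 1) := by
    have h1 : S - b N * t ^ N = ∑ n ∈ Finset.range N, (b n : ℝ) * t ^ n := by
      rw [hS, Finset.sum_range_succ]; ring
    have h2 : t ≤ ∑ n ∈ Finset.range N, t ^ (n + 1) := by
      have := Finset.single_le_sum (f := fun n => t ^ (n + 1)) (s := Finset.range N)
        (fun _ _ => by positivity) (Finset.mem_range.mpr hN)
      simpa using this
    calc (d : ℝ) * t * (S - b N * t ^ N) + t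
        ≤ d * t * (S - b N * t ^ N) + ∑ n ∈ Finset.range N, t ^ (n + 1) := by gcongr
      _ = _ := by
        rw [h1, Finset.mul_sum, ← Finset.sum_add_distrib]
        exact Finset.sum_congr rfl fun n _ => by ring
  -- Where the subtraction truncates, the index is 0 and the term vanishes because `b 0 = 0`.
  have hshift (m : ℕ) : ∑ n ∈ Finset.range N, (b (n + 1 - m) : ℝ) * t ^ (n + 1) ≤ t ^ m * S := by
    have h1 : ∑ n ∈ Finset.range N, (b (n + 1 - m) : ℝ) * t ^ (n + 1) ≤
        ∑ n ∈ Finset.range (N + 1), (b (n - m) : ℝ) * t ^ n := by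
      rw [Finset.sum_range_succ']
      simp [hb]
    have h2 : ∑ n ∈ Finset.range (N + 1), (b (n - m) : ℝ) * t ^ n ≤
        ∑ n ∈ Finset.range (m + (N + 1)), (b (n - m) : ℝ) * t ^ n :=
      Finset.sum_le_sum_of_subset_of_nonneg (Finset.range_mono (by omega))
        fun _ _ _ => by positivity
    have h3 : ∑ n ∈ Finset.range (m + (N + 1)), (b (n - m) : ℝ) * t ^ n = t ^ m * S := by
      rw [Finset.sum_range_add, Finset.sum_eq_zero, zero_add, hS, Finset.mul_sum]
      · exact Finset.sum_congr rfl fun n _ => by rw [Nat.add_sub_cancel_left]; ring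
      · intro n hn
        rw [Nat.sub_eq_zero_of_le (Finset.mem_range.mp hn).le, hb]; simp
    exact h1.trans (h2.trans h3.le)
  have hright : ∑ n ∈ Finset.range N, ((b (n + 1) : ℝ) + ∑ i, (b (n + 1 - ω i) : ℝ)) * t ^ (n + 1) ≤
      S + (∑ i, t ^ ω i) * S := by
    simp_rw [add_mul, Finset.sum_add_distrib, Finset.sum_mul]
    rw [Finset.sum_comm]
    refine add_le_add (by simpa using hshift 0) (Finset.sum_le_sum fun i _ => hshift (ω i))
  -- The terms containing `S` combine to `S` times the nonpositive value of the polynomial and drop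
  -- out.
  have key : t ≤ t * (d * t ^ N * b N) := by nlinarith
  exact le_of_mul_le_mul_left (by linarith) ht

theorem ofReal_one_div_le_limsup {c : ℕ → ℕ} {d : ℕ} {t : ℝ} (ht : 0 < t) (ht1 : t < 1)
    (h : ∀ N, 1 ≤ N → 1 ≤ d * t ^ N * ∑ i ∈ Finset.range N, (c i : ℝ)) :
    ENNReal.ofReal (1 / t) ≤
      Filter.limsup (fun n : ℕ => (c n : ℝ≥0∞) ^ (1 / n : ℝ)) Filter.atTop := by
  by_contra! hlt
  have h1 : (1 : ℝ≥0∞) < ENNReal.ofReal (1 / t) := by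
    rw [ENNReal.one_lt_ofReal]; exact (one_lt_div ht).mpr ht1
  -- Taking s > 1 as well lets a constant absorb the finitely many early `c i` and bounds the
  -- geometric sum by s^N/(s - 1).
  obtain ⟨s, hs1, hs2⟩ := exists_between (max_lt hlt h1)
  have hs_ne : s ≠ ⊤ := hs2.ne_top
  lift s to NNReal using hs_ne
  have hs1' : (1 : ℝ) < s := by exact_mod_cast (le_max_right _ _).trans_lt hs1
  have hst : t * s < 1 := by
    have := (ENNReal.lt_ofReal_iff_toReal_lt ENNReal.coe_ne_top).mp hs2
    rw [ENNReal.coe_toReal, lt_div_iff₀ ht] at this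
    linarith
  have hev := Filter.eventually_lt_of_limsup_lt ((le_max_left _ _).trans_lt hs1)
  obtain ⟨n₀, hn₀⟩ := Filter.eventually_atTop.mp hev
  have hc : ∀ n, n₀ + 1 ≤ n → (c n : ℝ) ≤ (s : ℝ) ^ n := by
    intro n hn
    have hn0 : (n : ℝ) ≠ 0 := by exact_mod_cast (by omega : n ≠ 0)
    have h2 := ENNReal.rpow_le_rpow (hn₀ n (by omega)).le (Nat.cast_nonneg (α := ℝ) n)
    rw [← ENNReal.rpow_mul, one_div_mul_cancel hn0, ENNReal.rpow_one, ENNReal.rpow_natCast] at h2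
    exact_mod_cast h2
  set C : ℝ := ∑ i ∈ Finset.range (n₀ + 1), (c i : ℝ)
  have hC : 0 ≤ C := Finset.sum_nonneg fun _ _ => by positivity
  have hcs : ∀ i, (c i : ℝ) ≤ (C + 1) * (s : ℝ) ^ i := by
    intro i
    have hp : (1 : ℝ) ≤ (s : ℝ) ^ i := one_le_pow₀ hs1'.le
    rcases lt_or_ge i (n₀ + 1) with hi | hi
    · have := Finset.single_le_sum (f := fun i => (c i : ℝ)) (s := Finset.range (n₀ + 1))
        (fun _ _ => by positivity) (Finset.mem_range.mpr hi)
      calc (c i : ℝ) ≤ C := this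
        _ ≤ (C + 1) * 1 := by linarith
        _ ≤ _ := by gcongr
    · exact (hc i hi).trans (le_mul_of_one_le_left (by positivity) (by linarith))
  have hbound : ∀ N, ∑ i ∈ Finset.range N, (c i : ℝ) ≤ (C + 1) / (s - 1) * (s : ℝ) ^ N := by
    intro N
    have hs0 : (0 : ℝ) < s - 1 := by linarith
    calc ∑ i ∈ Finset.range N, (c i : ℝ) ≤ ∑ i ∈ Finset.range N, (C + 1) * (s : ℝ) ^ i :=
          Finset.sum_le_sum fun i _ => hcs i
      _ = (C + 1) * (((s : ℝ) ^ N - 1) / (s - 1)) := by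
          rw [← Finset.mul_sum, geom_sum_eq hs1'.ne']
      _ ≤ (C + 1) * ((s : ℝ) ^ N / (s - 1)) := by gcongr; linarith
      _ = _ := by ring
  have hlim : Filter.Tendsto (fun N : ℕ => d * ((C + 1) / (s - 1)) * (t * s) ^ N) Filter.atTop
      (nhds (d * ((C + 1) / (s - 1)) * 0)) :=
    (tendsto_pow_atTop_nhds_zero_of_lt_one (by positivity) hst).const_mul _
  rw [mul_zero] at hlim
  obtain ⟨N, hN, hN1⟩ := ((hlim.eventually (gt_mem_nhds one_pos)).and
    (Filter.eventually_ge_atTop 1)).exists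
  have := calc 1 ≤ d * t ^ N * ∑ i ∈ Finset.range N, (c i : ℝ) := h N hN1
    _ ≤ d * t ^ N * ((C + 1) / (s - 1) * (s : ℝ) ^ N) := by gcongr; exact hbound N
    _ = d * ((C + 1) / (s - 1)) * (t * s) ^ N := by rw [mul_pow]; ring
  linarith

end Series

/-! ### The free algebra, its word filtration and left derivations. -/

section FreeAlgebra

variable {k : Type*} [Field k] {d : ℕ}

/-- The free associative algebra on `d` letters, with its basis of words. -/
abbrev WordAlgebra (k : Type*) [Field k] (d : ℕ) : Type _ := MonoidAlgebra k (FreeMonoid (Fin d))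

namespace WordAlgebra

/-- The `j`-th letter. -/
noncomputable def X (j : Fin d) : WordAlgebra k d := MonoidAlgebra.of k _ (FreeMonoid.of j)

/-- The ideal of the elements supported on words of length at least `n`. -/
noncomputable def ideal (k : Type*) [Field k] (d n : ℕ) : Ideal (WordAlgebra k d) where
  carrier := {f | ∀ w, w.length < n → f.coeff w = 0}
  add_mem' hf hg w hw := by simp [hf w hw, hg w hw]
  zero_mem' w _ := by simp
  smul_mem' f g hg w hw := by
    classical
    rw [smul_eq_mul, MonoidAlgebra.coeff_mul]
    refine Finset.sum_eq_zero fun a _ => Finset.sum_eq_zero fun b _ => ?_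
    dsimp only
    split_ifs with h
    · rw [hg b, mul_zero]
      rw [← h, FreeMonoid.length_mul] at hw
      omega
    · rfl

theorem mul_mem_ideal {m n : ℕ} {f g : WordAlgebra k d} (hf : f ∈ ideal k d m)
    (hg : g ∈ ideal k d n) : f * g ∈ ideal k d (m + n) := by
  classical
  intro w hw
  rw [MonoidAlgebra.coeff_mul]
  refine Finset.sum_eq_zero fun a _ => Finset.sum_eq_zero fun b _ => ?_
  dsimp only
  split_ifs with h
  · rw [← h, FreeMonoid.length_mul] at hw
    rcases lt_or_ge a.length m with ha | ha
    · rw [hf a ha, zero_mul]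
    · rw [hg b (by omega), mul_zero]
  · rfl

theorem ideal_anti {m n : ℕ} (h : m ≤ n) : ideal k d n ≤ ideal k d m :=
  fun _ hf w hw => hf w (hw.trans_le h)

@[simp] theorem ideal_zero : ideal k d 0 = ⊤ :=
  eq_top_iff.mpr fun _ _ _ hw => absurd hw (Nat.not_lt_zero _)

instance (n : ℕ) : (ideal k d n).IsTwoSided :=
  ⟨fun b ha => mul_mem_ideal ha (by simp : b ∈ ideal k d 0)⟩

theorem pow_mem_ideal {f : WordAlgebra k d} (hf : f ∈ ideal k d 1) (n : ℕ) :
    f ^ n ∈ ideal k d n := by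
  induction n with
  | zero => simp
  | succ n ih => rw [pow_succ]; exact mul_mem_ideal ih hf

theorem X_mem (j : Fin d) : (X j : WordAlgebra k d) ∈ ideal k d 1 := by
  intro w hw
  have hw : w = 1 := FreeMonoid.length_eq_zero.mp (by omega)
  subst hw
  rw [X, MonoidAlgebra.of_apply, MonoidAlgebra.coeff_single, Finsupp.single_eq_of_ne]
  exact (FreeMonoid.of_ne_one j).symm

/-- The `j`-th left derivation: it removes the first letter `j`. -/
noncomputable def D (j : Fin d) : WordAlgebra k d →ₗ[k] WordAlgebra k d where
  toFun f := .ofCoeff (f.coeff.comapDomain (FreeMonoid.of j * ·) (mul_right_injective _).injOn)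
  map_add' f g := by ext w; simp
  map_smul' c f := by ext w; simp

@[simp] theorem coeff_D (j : Fin d) (f : WordAlgebra k d) (w : FreeMonoid (Fin d)) :
    (D j f).coeff w = f.coeff (FreeMonoid.of j * w) := rfl

theorem D_mem_ideal (j : Fin d) {n : ℕ} {f : WordAlgebra k d} (hf : f ∈ ideal k d n) :
    D j f ∈ ideal k d (n - 1) := by
  intro w hw
  refine hf _ ?_
  rw [FreeMonoid.length_mul, FreeMonoid.length_of]
  omega

theorem coeff_X_mul (i j : Fin d) (f : WordAlgebra k d) (w : FreeMonoid (Fin d)) :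
    (X i * f).coeff (FreeMonoid.of j * w) = if i = j then f.coeff w else 0 := by
  rw [X, MonoidAlgebra.of_apply]
  split_ifs with h
  · subst h
    rw [MonoidAlgebra.coeff_single_mul_eq_mul_coeff w (by simp), one_mul]
  · apply MonoidAlgebra.coeff_single_mul_of_forall_mul_ne
    intro v hv
    have := congrArg (fun u => u.toList.head?) hv
    simp at this
    exact h this

theorem coeff_X_mul_one (i : Fin d) (f : WordAlgebra k d) : (X i * f).coeff 1 = 0 :=
  mul_mem_ideal (X_mem i) (by simp : f ∈ ideal k d 0) 1 (by simp)

@[simp] theorem D_X_mul (i j : Fin d) (f : WordAlgebra k d) :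
    D j (X i * f) = if i = j then f else 0 := by
  ext w
  rw [coeff_D, coeff_X_mul]
  split_ifs <;> simp

theorem D_sum_X_mul (j : Fin d) (y : Fin d → WordAlgebra k d) : D j (∑ i, X i * y i) = y j := by
  simp

theorem eq_smul_one_add_sum (f : WordAlgebra k d) :
    f = f.coeff 1 • (1 : WordAlgebra k d) + ∑ j, X j * D j f := by
  ext w
  rw [MonoidAlgebra.coeff_add, MonoidAlgebra.coeff_sum, Finsupp.add_apply, Finsupp.finsetSum_apply,
    MonoidAlgebra.coeff_smul, Finsupp.smul_apply]
  induction w using FreeMonoid.casesOn with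
  | one => simp [coeff_X_mul_one]
  | of_mul j w =>
    have h1 : (1 : WordAlgebra k d).coeff (FreeMonoid.of j * w) = 0 := by
      rw [MonoidAlgebra.one_def, MonoidAlgebra.coeff_single, Finsupp.single_eq_of_ne]
      intro h
      simpa using congrArg FreeMonoid.length h
    simp [coeff_X_mul, h1]

theorem eq_sum_X_mul {f : WordAlgebra k d} (hf : f ∈ ideal k d 1) : f = ∑ j, X j * D j f := by
  conv_lhs => rw [eq_smul_one_add_sum f, hf 1 (by simp), zero_smul, zero_add]

/-- The general rule D_j(fg) = D_j(f)g + ε(f)D_j(g) loses its last term when f has no constant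
coefficient. -/
theorem D_mul (j : Fin d) {f : WordAlgebra k d} (hf : f ∈ ideal k d 1) (g : WordAlgebra k d) :
    D j (f * g) = D j f * g := by
  conv_lhs => rw [eq_sum_X_mul hf, Finset.sum_mul]
  simp_rw [mul_assoc]
  exact D_sum_X_mul j fun i => D i f * g

/-- The constant coefficient. -/
noncomputable def ε (k : Type*) [Field k] (d : ℕ) : WordAlgebra k d →ₐ[k] k :=
  MonoidAlgebra.lift k k _ (FreeMonoid.lift fun _ => 0)

@[simp] theorem ε_X (j : Fin d) : ε k d (X j) = 0 := by
  simp [ε, X]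

theorem ε_eq (f : WordAlgebra k d) : ε k d f = f.coeff 1 := by
  conv_lhs => rw [eq_smul_one_add_sum f]
  simp

theorem mem_ideal_one_iff {f : WordAlgebra k d} : f ∈ ideal k d 1 ↔ ε k d f = 0 := by
  rw [ε_eq]
  refine ⟨fun h => h 1 (by simp), fun h w hw => ?_⟩
  rwa [FreeMonoid.length_eq_zero.mp (by omega : w.length = 0)]

instance finiteDimensional_quotient_ideal (n : ℕ) :
    FiniteDimensional k (WordAlgebra k d ⧸ (ideal k d n).restrictScalars k) := by
  induction n with
  | zero =>
    rw [ideal_zero]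
    have : Subsingleton (WordAlgebra k d ⧸ (⊤ : Ideal (WordAlgebra k d)).restrictScalars k) :=
      Submodule.Quotient.subsingleton_iff.mpr rfl
    infer_instance
  | succ n ih =>
    refine finiteDimensional_quotient_of_forall_eq_smul_add_sum (1 : WordAlgebra k d)
      (fun j => LinearMap.mulLeft k (X j)) (P := (ideal k d n).restrictScalars k) ?_
      fun f => ⟨_, fun j => D j f, eq_smul_one_add_sum f⟩
    intro j f hf
    have := mul_mem_ideal (X_mem j) hf
    rw [add_comm] at this
    exact this

/-! ### Quotients by relators and the Golod–Shafarevich inequality. -/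

section Relators

variable {ι : Type*}

/-- The two-sided ideal generated by a family. -/
noncomputable def relIdeal (w : ι → WordAlgebra k d) : Ideal (WordAlgebra k d) :=
  Ideal.span {x | ∃ i b, x = w i * b}

theorem mem_relIdeal (w : ι → WordAlgebra k d) (i : ι) : w i ∈ relIdeal w :=
  Ideal.subset_span ⟨i, 1, (mul_one _).symm⟩

instance (w : ι → WordAlgebra k d) : (relIdeal w).IsTwoSided where
  mul_mem_of_left {a} b ha := by
    induction ha using Submodule.span_induction with
    | mem x hx =>
      obtain ⟨i, c, rfl⟩ := hx
      exact Ideal.subset_span ⟨i, c * b, mul_assoc _ _ _⟩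
    | zero => simp
    | add x y _ _ hx hy => rw [add_mul]; exact add_mem hx hy
    | smul a x _ hx => rw [smul_eq_mul, mul_assoc]; exact Ideal.mul_mem_left _ _ hx

theorem relIdeal_le {w : ι → WordAlgebra k d} {n : ℕ} (hw : ∀ i, w i ∈ ideal k d n) :
    relIdeal w ≤ ideal k d n := by
  refine Ideal.span_le.mpr ?_
  rintro _ ⟨i, b, rfl⟩
  exact Ideal.mul_mem_right _ _ (hw i)

/-- Split a left multiplier a as its constant term plus ∑ X_j D_j(a). The constant only rescales the
`u i` and `κ j`, and the rest contributes X_j times an element of the ideal. -/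
theorem exists_of_mem_relIdeal [Fintype ι] {w : ι → WordAlgebra k d} {f : WordAlgebra k d}
    (hf : f ∈ relIdeal w) : ∃ (u : ι → WordAlgebra k d) (κ : Fin d → WordAlgebra k d),
      (∀ j, κ j ∈ relIdeal w) ∧ f = ∑ i, w i * u i + ∑ j, X j * κ j := by
  classical
  induction hf using Submodule.span_induction with
  | mem x hx =>
    obtain ⟨i, b, rfl⟩ := hx
    refine ⟨Pi.single i b, 0, by simp, ?_⟩
    rw [Finset.sum_eq_single i (by intro j _ hj; simp [hj]) (by simp)]
    simp
  | zero => exact ⟨0, 0, by simp, by simp⟩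
  | add x y _ _ hx hy =>
    obtain ⟨u, κ, hκ, rfl⟩ := hx
    obtain ⟨u', κ', hκ', rfl⟩ := hy
    refine ⟨u + u', κ + κ', fun j => add_mem (hκ j) (hκ' j), ?_⟩
    simp only [Pi.add_apply, mul_add, Finset.sum_add_distrib]
    abel
  | smul a x hx' hx =>
    obtain ⟨u, κ, hκ, h⟩ := hx
    refine ⟨fun i => a.coeff 1 • u i, fun j => a.coeff 1 • κ j + D j a * x,
      fun j => add_mem (Submodule.smul_of_tower_mem _ _ (hκ j)) (Ideal.mul_mem_left _ _ hx'), ?_⟩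
    have key : a * x = a.coeff 1 • x + ∑ j, X j * (D j a * x) := by
      conv_lhs => rw [eq_smul_one_add_sum a, add_mul, Finset.sum_mul]
      simp [mul_assoc]
    simp only [smul_eq_mul, mul_add, Finset.sum_add_distrib, mul_smul_comm]
    rw [key, ← add_assoc, ← Finset.smul_sum, ← Finset.smul_sum, ← smul_add, ← h]

/-- The dimensions of the truncations of the quotient of the free algebra by the relators `w`. -/
noncomputable def truncDim (w : ι → WordAlgebra k d) (n : ℕ) : ℕ :=
  Module.finrank k (WordAlgebra k d ⧸ (relIdeal w ⊔ ideal k d n).restrictScalars k)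

instance (w : ι → WordAlgebra k d) (n : ℕ) :
    FiniteDimensional k (WordAlgebra k d ⧸ (relIdeal w ⊔ ideal k d n).restrictScalars k) :=
  Module.Finite.of_surjective
    (((ideal k d n).restrictScalars k).mapQ ((relIdeal w ⊔ ideal k d n).restrictScalars k)
      LinearMap.id fun _ hx => Submodule.mem_sup_right hx) fun q => by
    obtain ⟨v, rfl⟩ := Submodule.mkQ_surjective _ q
    exact ⟨Submodule.mkQ _ v, rfl⟩

theorem truncDim_zero (w : ι → WordAlgebra k d) : truncDim w 0 = 0 := by
  have : Subsingleton
      (WordAlgebra k d ⧸ (relIdeal w ⊔ ideal k d 0).restrictScalars k) := by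
    rw [Submodule.Quotient.subsingleton_iff]
    simp
  exact Module.finrank_zero_of_subsingleton

/-- The Golod–Shafarevich inequality for truncations of a finitely presented algebra. -/
theorem golodShafarevich_recursion [Fintype ι] {w : ι → WordAlgebra k d} {ω : ι → ℕ}
    (hω : ∀ i, 1 ≤ ω i) (hw : ∀ i, w i ∈ ideal k d (ω i)) (n : ℕ) :
    d * truncDim w n + 1 ≤ truncDim w (n + 1) + ∑ i, truncDim w (n + 1 - ω i) := by
  classical
  let P (m : ℕ) : Submodule k (WordAlgebra k d) :=
    (relIdeal w ⊔ ideal k d m).restrictScalars k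
  have hw1 (i : ι) : w i ∈ ideal k d 1 := ideal_anti (hω i) (hw i)
  -- `D j (w i)` has order at least ω_i - 1, and (ω_i - 1) + (n + 1 - ω_i) ≥ n even when the second
  -- difference truncates to 0.
  have hα (j : Fin d) (i : ι) :
      P (n + 1 - ω i) ≤ (P n).comap (LinearMap.mulLeft k (D j (w i))) := by
    intro f hf
    obtain ⟨x, hx, y, hy, rfl⟩ := Submodule.mem_sup.mp hf
    have h2 := mul_mem_ideal (D_mem_ideal j (hw i)) hy
    have := hω i
    change D j (w i) * (x + y) ∈ relIdeal w ⊔ ideal k d n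
    rw [mul_add]
    exact add_mem (Submodule.mem_sup_left (Ideal.mul_mem_left _ _ hx))
      (Submodule.mem_sup_right (ideal_anti (by omega) h2))
  have hβ (j : Fin d) : P n ≤ (P (n + 1)).comap (LinearMap.mulLeft k (X j)) := by
    intro f hf
    obtain ⟨x, hx, y, hy, rfl⟩ := Submodule.mem_sup.mp hf
    have h2 := mul_mem_ideal (X_mem j) hy
    change X j * (x + y) ∈ relIdeal w ⊔ ideal k d (n + 1)
    rw [mul_add]
    exact add_mem (Submodule.mem_sup_left (Ideal.mul_mem_left _ _ hx))
      (Submodule.mem_sup_right (ideal_anti (by omega) h2))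
  have hε : P (n + 1) ≤ LinearMap.ker (ε k d).toLinearMap := by
    intro f hf
    have h1 : relIdeal w ⊔ ideal k d (n + 1) ≤ ideal k d 1 :=
      sup_le (relIdeal_le hw1) (ideal_anti (by omega))
    exact mem_ideal_one_iff.mp (h1 hf)
  let α : (∀ i, WordAlgebra k d ⧸ P (n + 1 - ω i)) →ₗ[k] Fin d → WordAlgebra k d ⧸ P n :=
    LinearMap.pi fun j => LinearMap.lsum k _ k fun i => (P (n + 1 - ω i)).mapQ (P n) _ (hα j i)
  let β : (Fin d → WordAlgebra k d ⧸ P n) →ₗ[k] WordAlgebra k d ⧸ P (n + 1) :=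
    LinearMap.lsum k _ k fun j => (P n).mapQ (P (n + 1)) _ (hβ j)
  have hαm (u : ι → WordAlgebra k d) (j : Fin d) :
      α (fun i => (P _).mkQ (u i)) j = (P n).mkQ (∑ i, D j (w i) * u i) := by
    rw [map_sum]
    simp [α]
  have hβm (y : Fin d → WordAlgebra k d) :
      β (fun j => (P n).mkQ (y j)) = (P (n + 1)).mkQ (∑ j, X j * y j) := by
    rw [map_sum]
    simp [β]
  have hlift (q : Fin d → WordAlgebra k d ⧸ P n) :
      ∃ y : Fin d → WordAlgebra k d, q = fun j => (P n).mkQ (y j) := by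
    choose y hy using fun j => (P n).mkQ_surjective (q j)
    exact ⟨y, funext fun j => (hy j).symm⟩
  have hmain := finrank_add_one_le_of_ker_le_range α β ((P (n + 1)).liftQ _ hε) ?_ ?_ ?_
  · rw [Module.finrank_pi_fintype, Module.finrank_pi_fintype] at hmain
    simpa [truncDim] using hmain
  -- If ∑ X_j y_j = ∑ w_i u_i + ∑ X_j κ_j + z with z ∈ J_{n+1}, applying D_j gives y_j = ∑ D_j(w_i)
  -- u_i + κ_j + D_j(z). The last two terms vanish modulo `P n`.
  · intro q hq
    obtain ⟨y, rfl⟩ := hlift q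
    rw [LinearMap.mem_ker, hβm, Submodule.mkQ_apply, Submodule.Quotient.mk_eq_zero] at hq
    obtain ⟨x, hx, z, hz, hxz⟩ := Submodule.mem_sup.mp hq
    obtain ⟨u, κ, hκ, rfl⟩ := exists_of_mem_relIdeal hx
    refine ⟨fun i => (P _).mkQ (u i), funext fun j => ?_⟩
    have hj := congrArg (D j) hxz
    rw [D_sum_X_mul, map_add, map_add, D_sum_X_mul, map_sum,
      Finset.sum_congr rfl fun i _ => D_mul j (hw1 i) (u i)] at hj
    rw [hαm, ← hj, Submodule.mkQ_apply, Submodule.mkQ_apply, Submodule.Quotient.eq,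
      add_assoc, sub_add_cancel_left]
    exact neg_mem (add_mem (Submodule.mem_sup_left (hκ j))
      (Submodule.mem_sup_right (D_mem_ideal j hz)))
  · refine LinearMap.ext fun q => ?_
    obtain ⟨y, rfl⟩ := hlift q
    rw [LinearMap.comp_apply, hβm]
    simp
  · intro h
    have := LinearMap.congr_fun h ((P (n + 1)).mkQ 1)
    simp at this

end Relators

end WordAlgebra

end FreeAlgebra

/-! ### The Iwasawa algebra: lifting homomorphisms, generators of the augmentation ideal,
finiteness. -/

section Iwasawa

variable {p : ℕ} [Fact p.Prime] {G : Type*} [Group G] [TopologicalSpace G]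

theorem monoidAlgebra_algHom_ext {k M A : Type*} [CommSemiring k] [Monoid M] [Semiring A]
    [Algebra k A] {f g : MonoidAlgebra k M →ₐ[k] A}
    (h : ∀ m, f (MonoidAlgebra.of k M m) = g (MonoidAlgebra.of k M m)) : f = g :=
  (MonoidAlgebra.lift k A M).symm.injective (MonoidHom.ext h)

theorem augmentation_eq (x : iwasawaAlgebra p G) (U : OpenNormalSubgroup G) :
    augmentation p G x = MonoidAlgebra.lift (ZMod p) (ZMod p) (G ⧸ U.toSubgroup) 1 (x.1 U) := by
  have hU : U ≤ topOpenNormal G := fun _ _ => trivial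
  change MonoidAlgebra.lift (ZMod p) (ZMod p) _ 1 (x.1 (topOpenNormal G)) = _
  rw [← x.2 U _ hU, ← AlgHom.comp_apply]
  congr 1
  refine monoidAlgebra_algHom_ext fun g => ?_
  simp [transition]

theorem iota_sub_one_mem (g : G) : iota p g - 1 ∈ augIdeal p G := by
  rw [augIdeal, RingHom.mem_ker, map_sub, augmentation_iota, map_one, sub_self]

/-- A homomorphism to an algebra that is trivial on an open normal subgroup extends to the Iwasawa
algebra. -/
noncomputable def iwasawaLift {A : Type*} [Ring A] [Algebra (ZMod p) A] (χ : G →* A) (U : OpenNormalSubgroup G)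
    (hU : ∀ g ∈ U, χ g = 1) : iwasawaAlgebra p G →ₐ[ZMod p] A :=
  (MonoidAlgebra.lift (ZMod p) A (G ⧸ U.toSubgroup) (QuotientGroup.lift U.toSubgroup χ hU)).comp
    ((Pi.evalAlgHom (ZMod p)
      (fun U : OpenNormalSubgroup G => MonoidAlgebra (ZMod p) (G ⧸ U.toSubgroup)) U).comp
        (iwasawaAlgebra p G).val)

section Lift

variable {A : Type*} [Ring A] [Algebra (ZMod p) A] {χ : G →* A} {U : OpenNormalSubgroup G}
  (hU : ∀ g ∈ U, χ g = 1)

@[simp] theorem iwasawaLift_iota (g : G) : iwasawaLift χ U hU (iota p g) = χ g := by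
  change MonoidAlgebra.lift (ZMod p) A (G ⧸ U.toSubgroup) _ (MonoidAlgebra.of _ _ _) = _
  rw [MonoidAlgebra.lift_of]
  rfl

theorem iwasawaLift_augmentation {ε : A →ₐ[ZMod p] ZMod p} (hε : ∀ g, ε (χ g) = 1)
    (x : iwasawaAlgebra p G) : ε (iwasawaLift χ U hU x) = augmentation p G x := by
  rw [augmentation_eq x U]
  change ε (MonoidAlgebra.lift (ZMod p) A (G ⧸ U.toSubgroup) _ (x.1 U)) = _
  rw [← AlgHom.comp_apply]
  congr 1
  refine monoidAlgebra_algHom_ext fun g => ?_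
  obtain ⟨g, rfl⟩ := QuotientGroup.mk_surjective g
  rw [AlgHom.comp_apply, MonoidAlgebra.lift_of, MonoidAlgebra.lift_of]
  exact hε g

end Lift

/-- The g with g - 1 in the left ideal L form a subgroup, by xy - 1 = x(y - 1) + (x - 1). By
linearity every f is then congruent to its augmentation modulo L. -/
theorem exists_eq_sum_mul_of_sub_one {k Q : Type*} [Field k] [Group Q] {d : ℕ} {s : Fin d → Q}
    (hs : Subgroup.closure (Set.range s) = ⊤) {f : MonoidAlgebra k Q}
    (hf : MonoidAlgebra.lift k k Q 1 f = 0) :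
    ∃ y : Fin d → MonoidAlgebra k Q, ∑ j, y j * (MonoidAlgebra.of k Q (s j) - 1) = f := by
  let L : Ideal (MonoidAlgebra k Q) :=
    Ideal.span (Set.range fun j => MonoidAlgebra.of k Q (s j) - 1)
  have hg (g : Q) : MonoidAlgebra.of k Q g - 1 ∈ L := by
    have hmem : g ∈ Subgroup.closure (Set.range s) := hs ▸ Subgroup.mem_top g
    induction hmem using Subgroup.closure_induction with
    | mem x hx =>
      obtain ⟨j, rfl⟩ := hx
      exact Ideal.subset_span ⟨j, rfl⟩
    | one => rw [map_one, sub_self]; exact zero_mem _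
    | mul x y _ _ hx hy =>
      have : MonoidAlgebra.of k Q (x * y) - 1 =
          MonoidAlgebra.of k Q x * (MonoidAlgebra.of k Q y - 1) +
            (MonoidAlgebra.of k Q x - 1) := by
        rw [map_mul]; noncomm_ring
      rw [this]
      exact add_mem (L.mul_mem_left _ hy) hx
    | inv x _ hx =>
      have : MonoidAlgebra.of k Q x⁻¹ - 1 =
          -(MonoidAlgebra.of k Q x⁻¹ * (MonoidAlgebra.of k Q x - 1)) := by
        rw [mul_sub, ← map_mul, inv_mul_cancel, map_one, mul_one, neg_sub]
      rw [this]
      exact neg_mem (L.mul_mem_left _ hx)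
  have hall (f : MonoidAlgebra k Q) :
      f - algebraMap k _ (MonoidAlgebra.lift k k Q 1 f) ∈ L := by
    induction f using MonoidAlgebra.induction_on with
    | of g => rw [MonoidAlgebra.lift_of, MonoidHom.one_apply, map_one]; exact hg g
    | add f g hf hg =>
      rw [map_add, map_add, add_sub_add_comm]
      exact add_mem hf hg
    | smul c f hf =>
      have : c • f - algebraMap k _ (MonoidAlgebra.lift k k Q 1 (c • f)) =
          algebraMap k _ c * (f - algebraMap k _ (MonoidAlgebra.lift k k Q 1 f)) := by
        rw [mul_sub, ← Algebra.smul_def, map_smul, smul_eq_mul, map_mul]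
      rw [this]
      exact L.mul_mem_left _ hf
  have hfL := hall f
  rw [hf, map_zero, sub_zero] at hfL
  exact (Submodule.mem_span_range_iff_exists_fun _).mp hfL

section Compact

variable [IsTopologicalGroup G] [CompactSpace G] {d : ℕ} {s : Fin d → G}

open CategoryTheory in
/-- The augmentation ideal is generated, as a left ideal, by `s_j - 1` if the family `s` generates
all finite continuous quotients. -/
theorem exists_eq_sum_mul_iota_sub_one
    (hs : ∀ U : OpenNormalSubgroup G,
      Subgroup.closure (Set.range fun j => (s j : G ⧸ U.toSubgroup)) = ⊤)
    {x : iwasawaAlgebra p G} (hx : x ∈ augIdeal p G) :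
    ∃ y : Fin d → iwasawaAlgebra p G, x = ∑ j, y j * (iota p (s j) - 1) := by
  -- Compactness: the solution sets at the finite levels are finite and nonempty, so their inverse
  -- limit is nonempty. A coherent family of solutions is a tuple in Ω(G).
  let Sol (U : OpenNormalSubgroup G) : Type _ :=
    {y : Fin d → MonoidAlgebra (ZMod p) (G ⧸ U.toSubgroup) //
      ∑ j, y j * (MonoidAlgebra.of (ZMod p) _ (s j : G ⧸ U.toSubgroup) - 1) = x.1 U}
  have htr (U V : OpenNormalSubgroup G) (h : U ≤ V) (g : G) :
      transition p h (MonoidAlgebra.of (ZMod p) _ (g : G ⧸ U.toSubgroup)) =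
        MonoidAlgebra.of (ZMod p) _ (g : G ⧸ V.toSubgroup) := (iota p g).2 U V h
  let res {U V : OpenNormalSubgroup G} (h : U ≤ V) (y : Sol U) : Sol V :=
    ⟨fun j => transition p h (y.1 j), by
      refine Eq.trans ?_ ((congrArg (transition p h) y.2).trans (x.2 U V h))
      rw [map_sum]
      refine Finset.sum_congr rfl fun j _ => ?_
      rw [map_mul, map_sub, map_one, htr]⟩
  have hid (U : OpenNormalSubgroup G) (z : MonoidAlgebra (ZMod p) (G ⧸ U.toSubgroup)) :
      transition p (le_refl U) z = z := by
    have : transition p (le_refl U) = AlgHom.id (ZMod p) _ := by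
      refine monoidAlgebra_algHom_ext fun g => ?_
      obtain ⟨g, rfl⟩ := QuotientGroup.mk_surjective g
      exact htr U U le_rfl g
    rw [this]; rfl
  have hcomp (U V W : OpenNormalSubgroup G) (h : U ≤ V) (h' : V ≤ W)
      (z : MonoidAlgebra (ZMod p) (G ⧸ U.toSubgroup)) :
      transition p (h.trans h') z = transition p h' (transition p h z) := by
    have : transition p (h.trans h') = (transition p h').comp (transition p h) := by
      refine monoidAlgebra_algHom_ext fun g => ?_
      obtain ⟨g, rfl⟩ := QuotientGroup.mk_surjective g
      exact (htr U W (h.trans h') g).trans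
        ((htr V W h' g).symm.trans (congrArg _ (htr U V h g).symm))
    rw [this]; rfl
  have hres_id (U : OpenNormalSubgroup G) (y : Sol U) : res (le_refl U) y = y :=
    Subtype.ext (funext fun j => hid U (y.1 j))
  have hres_comp (U V W : OpenNormalSubgroup G) (h : U ≤ V) (h' : V ≤ W) (y : Sol U) :
      res (h.trans h') y = res h' (res h y) :=
    Subtype.ext (funext fun j => hcomp U V W h h' (y.1 j))
  let Φ : OpenNormalSubgroup G ⥤ Type _ :=
    { obj := Sol
      map := fun {U V} f => ↾(res (leOfHom f))
      map_id := fun U => ConcreteCategory.hom_ext _ _ fun y => hres_id U y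
      map_comp := fun {U V W} f g => 
        ConcreteCategory.hom_ext _ _ fun y => hres_comp U V W (leOfHom f) (leOfHom g) y }
  have hfin (U : OpenNormalSubgroup G) : Finite (Φ.obj U) := by
    have : Finite (G ⧸ U.toSubgroup) := inferInstanceAs (Finite (G ⧸ U.toOpenSubgroup.toSubgroup))
    have : Finite (MonoidAlgebra (ZMod p) (G ⧸ U.toSubgroup)) :=
      Finite.of_injective (fun f q => f.coeff q) fun f g h =>
        MonoidAlgebra.coeff_injective (DFunLike.coe_injective h)
    exact inferInstanceAs (Finite (Subtype _))
  have hne (U : OpenNormalSubgroup G) : Nonempty (Φ.obj U) := by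
    obtain ⟨y, hy⟩ := exists_eq_sum_mul_of_sub_one (hs U) (f := x.1 U) (by
      rw [← augmentation_eq]; exact hx)
    exact ⟨⟨y, hy⟩⟩
  obtain ⟨u, hu⟩ := nonempty_sections_of_finite_cofiltered_system Φ
  refine ⟨fun j => ⟨fun U => (u U).1 j, fun U V h => ?_⟩, ?_⟩
  · have := hu (homOfLE h)
    exact congrFun (congrArg Subtype.val this) j
  · refine Subtype.ext (funext fun U => ?_)
    rw [← (u U).2]
    simp [iota]

/-- `Module.finrank` is 0 in infinite dimension, so this finiteness is needed both to add up the
`hilbertCoeff` and to compare dimensions along a surjection. -/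
theorem finiteDimensional_quotient_augPow
    (hs : ∀ U : OpenNormalSubgroup G,
      Subgroup.closure (Set.range fun j => (s j : G ⧸ U.toSubgroup)) = ⊤) (n : ℕ) :
    FiniteDimensional (ZMod p) (iwasawaAlgebra p G ⧸ augPow p G n) := by
  induction n with
  | zero =>
    have : Subsingleton (iwasawaAlgebra p G ⧸ augPow p G 0) := by
      rw [Submodule.Quotient.subsingleton_iff, augPow, Submodule.pow_zero]
      simp
    infer_instance
  | succ n ih =>
    refine finiteDimensional_quotient_of_forall_eq_smul_add_sum (1 : iwasawaAlgebra p G)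
      (fun j => LinearMap.mulRight (ZMod p) (iota p (s j) - 1)) (P := augPow p G n) ?_ ?_
    · intro j x hx
      change x * (iota p (s j) - 1) ∈ augIdeal p G ^ (n + 1)
      rw [Submodule.pow_succ]
      exact Ideal.mul_mem_mul hx (iota_sub_one_mem _)
    · intro x
      obtain ⟨y, hy⟩ := exists_eq_sum_mul_iota_sub_one hs
        (x := x - algebraMap (ZMod p) _ (augmentation p G x)) (by
          rw [augIdeal, RingHom.mem_ker, map_sub, AlgHom.commutes]; simp)
      refine ⟨augmentation p G x, y, ?_⟩
      simp only [LinearMap.mulRight_apply]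
      rw [← hy, ← Algebra.algebraMap_eq_smul_one, add_sub_cancel]

theorem finrank_quotient_augPow
    (hs : ∀ U : OpenNormalSubgroup G,
      Subgroup.closure (Set.range fun j => (s j : G ⧸ U.toSubgroup)) = ⊤) (n : ℕ) :
    Module.finrank (ZMod p) (iwasawaAlgebra p G ⧸ augPow p G n) =
      ∑ i ∈ Finset.range n, hilbertCoeff p G i := by
  induction n with
  | zero =>
    have : Subsingleton (iwasawaAlgebra p G ⧸ augPow p G 0) := by
      rw [Submodule.Quotient.subsingleton_iff, augPow, Submodule.pow_zero]
      simp
    simpa using Module.finrank_zero_of_subsingleton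
  | succ n ih =>
    have := finiteDimensional_quotient_augPow (p := p) hs (n + 1)
    have hle : augPow p G (n + 1) ≤ augPow p G n := Ideal.pow_le_pow_right n.le_succ
    rw [finrank_quotient_eq_add hle, ih, Finset.sum_range_succ, hilbertCoeff]

end Compact

end Iwasawa

/-! ### Depth and powers of the augmentation ideal. -/

section Depth

variable {p : ℕ} {G : Type*} [Group G] [TopologicalSpace G]

theorem iota_sub_one_mem_pow_of_depth_eq_top {x : G} (hx : depth p x = ⊤) (n : ℕ) :
    iota p x - 1 ∈ augIdeal p G ^ n := by
  obtain ⟨_, ⟨m, rfl, hm⟩, hnm⟩ := sSup_eq_top.mp hx n (ENat.natCast_lt_top n)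
  exact Ideal.pow_le_pow_right (by exact_mod_cast hnm.le) hm

/-- A finite supremum is attained. At infinite depth `toNat` is 0 and the zeroth power is
everything. -/
theorem iota_sub_one_mem_pow_depth (x : G) :
    iota p x - 1 ∈ augIdeal p G ^ (depth p x).toNat := by
  by_contra hn
  have hlt (m : ℕ) (hm : iota p x - 1 ∈ augIdeal p G ^ m) : m < (depth p x).toNat := by
    by_contra! h
    exact hn (Ideal.pow_le_pow_right h hm)
  have h0 : 0 < (depth p x).toNat := hlt 0 (by rw [Submodule.pow_zero]; simp)
  have hle : depth p x ≤ ((depth p x).toNat - 1 : ℕ) := by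
    refine sSup_le ?_
    rintro _ ⟨m, rfl, hm⟩
    have := hlt m hm
    exact_mod_cast (by omega : m ≤ (depth p x).toNat - 1)
  have := ENat.toNat_le_of_le_natCast hle
  omega

theorem one_le_toNat_depth [Fact p.Prime] {x : G} (hx : depth p x ≠ ⊤) :
    1 ≤ (depth p x).toNat := by
  have h : ((1 : ℕ) : ℕ∞) ≤ depth p x := by
    refine le_sSup ⟨1, rfl, ?_⟩
    change _ ∈ augIdeal p G ^ 1
    rw [Submodule.pow_one]
    exact iota_sub_one_mem x
  exact (ENat.toNat_le_toNat h hx)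

end Depth

/-! ### Truncated free algebras and their principal units. -/

section Truncation

open WordAlgebra

variable {p : ℕ} [Fact p.Prime] {d : ℕ}

/-- The augmentation of a quotient of the free algebra. -/
noncomputable def quotientAug (Q : Ideal (WordAlgebra (ZMod p) d)) [Q.IsTwoSided]
    (hQ : Q ≤ ideal (ZMod p) d 1) : WordAlgebra (ZMod p) d ⧸ Q →ₐ[ZMod p] ZMod p :=
  Ideal.Quotient.liftₐ Q (ε (ZMod p) d) fun _ hf => mem_ideal_one_iff.mp (hQ hf)

section Quotient

variable {Q : Ideal (WordAlgebra (ZMod p) d)} [Q.IsTwoSided] (hQ : Q ≤ ideal (ZMod p) d 1)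

@[simp] theorem quotientAug_mk (f : WordAlgebra (ZMod p) d) :
    quotientAug Q hQ (Ideal.Quotient.mk Q f) = ε (ZMod p) d f := rfl

/-- A map of augmented algebras from the Iwasawa algebra to a quotient of the free algebra respects
the filtrations. -/
theorem exists_mem_ideal_of_mem_augIdeal_pow {G : Type*} [Group G] [TopologicalSpace G]
    {Λ : iwasawaAlgebra p G →ₐ[ZMod p] WordAlgebra (ZMod p) d ⧸ Q}
    (hΛ : ∀ x, quotientAug Q hQ (Λ x) = augmentation p G x) {n : ℕ} {x : iwasawaAlgebra p G}
    (hx : x ∈ augIdeal p G ^ n) :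
    ∃ f ∈ ideal (ZMod p) d n, Ideal.Quotient.mk Q f = Λ x := by
  induction n generalizing x with
  | zero =>
    obtain ⟨f, hf⟩ := Ideal.Quotient.mk_surjective (Λ x)
    exact ⟨f, by simp, hf⟩
  | succ n ih =>
    rw [Submodule.pow_succ] at hx
    induction hx using Submodule.smul_induction_on' with
    | smul r hr s hs =>
      obtain ⟨f, hf, hfr⟩ := ih hr
      obtain ⟨g, hg⟩ := Ideal.Quotient.mk_surjective (Λ s)
      have hg1 : g ∈ ideal (ZMod p) d 1 := by
        rw [mem_ideal_one_iff, ← quotientAug_mk hQ, hg, hΛ]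
        exact hs
      exact ⟨f * g, mul_mem_ideal hf hg1, by rw [map_mul, hfr, hg, smul_eq_mul, map_mul]⟩
    | add x _ y _ hx hy =>
      obtain ⟨f, hf, hfx⟩ := hx
      obtain ⟨g, hg, hgy⟩ := hy
      exact ⟨f + g, add_mem hf hg, by rw [map_add, hfx, hgy, map_add]⟩

end Quotient

/-- The truncated free algebra, in which the words of length greater than `N` vanish. -/
abbrev Truncation (p : ℕ) [Fact p.Prime] (d N : ℕ) : Type :=
  WordAlgebra (ZMod p) d ⧸ ideal (ZMod p) d (N + 1)

/-- The augmentation of the truncated free algebra. -/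
noncomputable def truncationAug (p : ℕ) [Fact p.Prime] (d N : ℕ) :
    Truncation p d N →ₐ[ZMod p] ZMod p :=
  quotientAug _ (ideal_anti (Nat.le_add_left 1 N))

instance (N : ℕ) : Finite (Truncation p d N) := by
  have : Finite (WordAlgebra (ZMod p) d ⧸
      (ideal (ZMod p) d (N + 1)).restrictScalars (ZMod p)) :=
    Module.finite_of_finite (ZMod p)
  exact Finite.of_equiv _
    (Submodule.Quotient.restrictScalarsEquiv (ZMod p) (ideal (ZMod p) d (N + 1))).toEquiv

/-- The group of principal units of the truncated free algebra. -/
noncomputable def principalUnits (p : ℕ) [Fact p.Prime] (d N : ℕ) :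
    Subgroup (Truncation p d N)ˣ :=
  (Units.map (truncationAug p d N : Truncation p d N →* ZMod p)).ker

theorem mem_principalUnits {N : ℕ} {u : (Truncation p d N)ˣ} :
    u ∈ principalUnits p d N ↔ truncationAug p d N u = 1 := by
  rw [principalUnits, MonoidHom.mem_ker, Units.ext_iff]
  rfl

/-- In characteristic p, f^{p^{N+1}} - 1 = (f - 1)^{p^{N+1}}, which lies in J_{N+1} since N + 1 <
p^{N+1}. -/
theorem isPGroup_principalUnits (N : ℕ) : IsPGroup p (principalUnits p d N) := by
  rintro ⟨u, hu⟩
  refine ⟨N + 1, ?_⟩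
  obtain ⟨f, hf⟩ := Ideal.Quotient.mk_surjective (u : Truncation p d N)
  have hf1 : f - 1 ∈ ideal (ZMod p) d 1 := by
    rw [mem_principalUnits, ← hf] at hu
    rw [mem_ideal_one_iff, map_sub, map_one, sub_eq_zero]
    exact hu
  have : CharP (WordAlgebra (ZMod p) d) p := charP_of_injective_algebraMap' (ZMod p) p
  have hpow : f ^ p ^ (N + 1) - 1 = (f - 1) ^ p ^ (N + 1) := by
    rw [sub_pow_char_pow_of_commute _ _ (Commute.one_right f), one_pow]
  have hmem : f ^ p ^ (N + 1) - 1 ∈ ideal (ZMod p) d (N + 1) := by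
    rw [hpow]
    exact ideal_anti (Nat.lt_pow_self (Fact.out : p.Prime).one_lt).le (pow_mem_ideal hf1 _)
  rw [← Ideal.Quotient.eq, map_pow, map_one, hf] at hmem
  exact Subtype.ext (Units.ext hmem)

theorem exists_principalUnit (N : ℕ) (j : Fin d) :
    ∃ u : principalUnits p d N, ((u : (Truncation p d N)ˣ) : Truncation p d N) =
      Ideal.Quotient.mk _ (1 + X j) := by
  have hnil : IsNilpotent (Ideal.Quotient.mk (ideal (ZMod p) d (N + 1)) (X j)) := by
    refine ⟨N + 1, ?_⟩
    rw [← map_pow, Ideal.Quotient.eq_zero_iff_mem]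
    exact pow_mem_ideal (X_mem j) _
  obtain ⟨u, hu⟩ := hnil.isUnit_one_add
  have hu' : (u : Truncation p d N) = Ideal.Quotient.mk _ (1 + X j) := by
    rw [hu, map_add, map_one]
  refine ⟨⟨u, ?_⟩, hu'⟩
  rw [mem_principalUnits, hu', truncationAug, quotientAug_mk]
  simp

end Truncation

/-! ### The Magnus map, generation of finite quotients, and descent to G. -/

section Presentation

open WordAlgebra

variable {p : ℕ} [Fact p.Prime] {F : Type*} [Group F] [TopologicalSpace F] [IsTopologicalGroup F]
  {d : ℕ} {σ : Fin d → F}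

/-- The truncated Magnus homomorphism. -/
theorem IsFreeProP.exists_magnus (hF : IsFreeProP p σ) (N : ℕ) :
    ∃ χ : F →* (Truncation p d N)ˣ, IsOpen (χ.ker : Set F) ∧
      (∀ g, truncationAug p d N (χ g) = 1) ∧
      ∀ j, (χ (σ j) : Truncation p d N) = Ideal.Quotient.mk _ (1 + X j) := by
  choose u hu using exists_principalUnit (p := p) (d := d) N
  let _ : TopologicalSpace (principalUnits p d N) := ⊥
  have : DiscreteTopology (principalUnits p d N) := ⟨rfl⟩
  obtain ⟨ψ, hψ, -⟩ := hF.existsUnique_lift _ (isPGroup_principalUnits N) u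
  refine ⟨(principalUnits p d N).subtype.comp ψ.toMonoidHom, ?_, fun g => ?_, fun j => ?_⟩
  · have : ((((principalUnits p d N).subtype.comp ψ.toMonoidHom).ker : Subgroup F) : Set F) =
        ψ ⁻¹' {1} := by
      ext g
      simp [MonoidHom.mem_ker]
    rw [this]
    exact (isOpen_discrete _).preimage ψ.continuous_toFun
  · exact mem_principalUnits.mp (ψ g).2
  · rw [← hu j, ← hψ j]
    rfl

/-- The universal property maps F into the subgroup H generated by the images. By uniqueness this
map followed by the inclusion is the quotient map, which is surjective, so H is everything. -/
theorem IsFreeProP.closure_range_eq_top (hF : IsFreeProP p σ) {G : Type*} [Group G]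
    [TopologicalSpace G] [IsTopologicalGroup G] (hG : IsProP p G) {φ : F →ₜ* G}
    (hφ : Function.Surjective φ) (U : OpenNormalSubgroup G) :
    Subgroup.closure (Set.range fun j => (φ (σ j) : G ⧸ U.toSubgroup)) = ⊤ := by
  obtain ⟨m, hm⟩ := hG.index_eq U
  have : Finite (G ⧸ U.toSubgroup) := by
    refine Nat.finite_of_card_ne_zero ?_
    rw [← Subgroup.index_eq_card, hm]
    exact pow_ne_zero _ (Fact.out : p.Prime).ne_zero
  -- The universal property tests only groups in `Type`, hence the small copy of the finite
  -- quotient.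
  let H : Subgroup (Shrink.{0} (G ⧸ U.toSubgroup)) :=
    Subgroup.closure (Set.range fun j => equivShrink _ (φ (σ j) : G ⧸ U.toSubgroup))
  let e : Shrink.{0} (G ⧸ U.toSubgroup) ≃* G ⧸ U.toSubgroup := Shrink.mulEquiv
  let _ : TopologicalSpace (Shrink.{0} (G ⧸ U.toSubgroup)) := ⊥
  have : DiscreteTopology (Shrink.{0} (G ⧸ U.toSubgroup)) := ⟨rfl⟩
  have hp : IsPGroup p (Shrink.{0} (G ⧸ U.toSubgroup)) :=
    (IsPGroup.of_card (n := m) (by rw [← Subgroup.index_eq_card, hm])).of_equiv e.symm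
  have hdisc : DiscreteTopology (G ⧸ U.toSubgroup) :=
    inferInstanceAs (DiscreteTopology (G ⧸ U.toOpenSubgroup.toSubgroup))
  let f : F →ₜ* Shrink.{0} (G ⧸ U.toSubgroup) :=
    { toMonoidHom := e.symm.toMonoidHom.comp ((QuotientGroup.mk' U.toSubgroup).comp φ.toMonoidHom)
      continuous_toFun := (continuous_of_discreteTopology (f := e.symm)).comp
        (QuotientGroup.continuous_mk.comp φ.continuous_toFun) }
  obtain ⟨ψ, hψ, -⟩ := hF.existsUnique_lift H (hp.to_subgroup H)
    fun j => ⟨f (σ j), Subgroup.subset_closure ⟨j, rfl⟩⟩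
  let ψ' : F →ₜ* Shrink.{0} (G ⧸ U.toSubgroup) :=
    { toMonoidHom := H.subtype.comp ψ.toMonoidHom
      continuous_toFun := continuous_subtype_val.comp ψ.continuous_toFun }
  have hψf : ψ' = f :=
    (hF.existsUnique_lift _ hp fun j => f (σ j)).unique
      (fun j => congrArg Subtype.val (hψ j)) fun _ => rfl
  have hH : H = ⊤ := by
    rw [eq_top_iff]
    intro q _
    obtain ⟨g, hg⟩ := QuotientGroup.mk_surjective (e q)
    obtain ⟨x, rfl⟩ := hφ g
    have : q = ψ' x := by
      rw [hψf, ← e.symm_apply_apply q, ← hg]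
      rfl
    rw [this]
    exact (ψ x).2
  have hmap := congrArg (Subgroup.map e.toMonoidHom) hH
  rw [MonoidHom.map_closure, ← Set.range_comp, Subgroup.map_top_of_surjective _ e.surjective]
    at hmap
  rw [← hmap]
  congr 1
  ext q
  refine exists_congr fun j => ?_
  rw [Function.comp_apply]
  exact Eq.congr_left (e.apply_symm_apply (φ (σ j) : G ⧸ U.toSubgroup)).symm

omit [IsTopologicalGroup F] in
-- A continuous surjection from a compact space to a Hausdorff space is a quotient map, so openness
-- of the kernel passes from F to G.
theorem exists_descend [CompactSpace F] {G : Type*} [Group G] [TopologicalSpace G] [T2Space G]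
    {φ : F →ₜ* G} (hφ : Function.Surjective φ) {A : Type*} [Group A] {χ : F →* A}
    (hopen : IsOpen (χ.ker : Set F)) (hker : φ.toMonoidHom.ker ≤ χ.ker) :
    ∃ (χ' : G →* A) (U : OpenNormalSubgroup G), (∀ g ∈ U, χ' g = 1) ∧
      ∀ g, χ' (φ g) = χ g := by
  let χ' : G →* A := φ.toMonoidHom.liftOfSurjective hφ ⟨χ, hker⟩
  have hχ' (g : F) : χ' (φ g) = χ g := φ.toMonoidHom.liftOfRightInverse_comp_apply _ _ ⟨χ, hker⟩ g
  have hq : Topology.IsQuotientMap φ :=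
    φ.continuous_toFun.isClosedMap.isQuotientMap φ.continuous_toFun hφ
  have hU : IsOpen (χ'.ker : Set G) := by
    rw [← hq.isOpen_preimage]
    convert hopen using 1
    ext g
    simp [MonoidHom.mem_ker, hχ']
  exact ⟨χ', { toSubgroup := χ'.ker, isOpen' := hU, isNormal' := inferInstance },
    fun g hg => hg, hχ'⟩

end Presentation

/-! ### Comparing Ω(G) with the truncated quotient algebra. -/

section Presentation

open WordAlgebra

variable {p : ℕ} [Fact p.Prime] {F : Type*} [Group F] [TopologicalSpace F] [IsTopologicalGroup F]
  {G : Type*} [Group G] [TopologicalSpace G] [IsTopologicalGroup G]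
  {d r : ℕ} {σ : Fin d → F} {rel : Fin r → F} {φ : F →ₜ* G}

/-- The relators of finite depth, modulo words of length greater than `N`, lift to elements of the
free algebra whose quotient is dominated by the Iwasawa algebra of the presented group. -/
theorem exists_relators_truncDim_le (hF : IsFreeProP p σ) (hG : IsProP p G)
    (hφ : Function.Surjective φ)
    (hker : φ.toMonoidHom.ker = (Subgroup.normalClosure (Set.range rel)).topologicalClosure)
    (N : ℕ) :
    ∃ w : {i // depth p (rel i) ≠ ⊤} → WordAlgebra (ZMod p) d,
      (∀ i, w i ∈ ideal (ZMod p) d (depth p (rel i.1)).toNat) ∧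
      truncDim w (N + 1) ≤
        Module.finrank (ZMod p) (iwasawaAlgebra p G ⧸ augPow p G (N + 1)) := by
  have := hF.isProP.compactSpace
  have := hG.compactSpace
  have := hG.totallyDisconnectedSpace
  have : T1Space G := inferInstance
  have : T2Space G := inferInstance
  obtain ⟨χ, hχo, hχε, hχσ⟩ := hF.exists_magnus N
  have hN1 : ideal (ZMod p) d (N + 1) ≤ ideal (ZMod p) d 1 := ideal_anti (Nat.le_add_left 1 N)
  let UF : OpenNormalSubgroup F :=
    { toSubgroup := χ.ker, isOpen' := hχo, isNormal' := inferInstance }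
  let ΛF : iwasawaAlgebra p F →ₐ[ZMod p] Truncation p d N :=
    iwasawaLift ((Units.coeHom _).comp χ) UF fun g hg => congrArg Units.val hg
  have hΛF (x) : quotientAug _ hN1 (ΛF x) = augmentation p F x :=
    iwasawaLift_augmentation _ hχε x
  have hΛFι (g : F) : ΛF (iota p g - 1) = (χ g : Truncation p d N) - 1 := by
    rw [map_sub, map_one]
    exact congrArg (· - 1) (iwasawaLift_iota _ g)
  -- `w i` lifts `χ (rel i) - 1`; it can be chosen of order at least the depth because `ΛF` respects
  -- the filtrations.
  choose w hw hwχ using fun i : {i // depth p (rel i) ≠ ⊤} =>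
    exists_mem_ideal_of_mem_augIdeal_pow hN1 hΛF (iota_sub_one_mem_pow_depth (p := p) (rel i))
  have hdepth (i : {i // depth p (rel i) ≠ ⊤}) : 1 ≤ (depth p (rel i)).toNat :=
    one_le_toNat_depth i.2
  refine ⟨w, hw, ?_⟩
  let Q : Ideal (WordAlgebra (ZMod p) d) := relIdeal w ⊔ ideal (ZMod p) d (N + 1)
  have : Q.IsTwoSided := ⟨fun {a} b ha => by
    obtain ⟨x, hx, y, hy, rfl⟩ := Submodule.mem_sup.mp ha
    rw [add_mul]
    exact add_mem (Submodule.mem_sup_left (Ideal.mul_mem_right b _ hx))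
      (Submodule.mem_sup_right (Ideal.mul_mem_right b _ hy))⟩
  have hQ : Q ≤ ideal (ZMod p) d 1 :=
    sup_le (relIdeal_le fun i => ideal_anti (hdepth i) (hw i)) hN1
  let π : Truncation p d N →+* WordAlgebra (ZMod p) d ⧸ Q := Ideal.Quotient.factor le_sup_right
  have hπ (f) : π (Ideal.Quotient.mk _ f) = Ideal.Quotient.mk Q f := rfl
  let χQ : F →* (WordAlgebra (ZMod p) d ⧸ Q)ˣ := (Units.map (π : _ →* _)).comp χ
  have hχQ (g : F) : (χQ g : WordAlgebra (ZMod p) d ⧸ Q) = π (χ g) := rfl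
  have hrel (i : Fin r) : rel i ∈ χQ.ker := by
    suffices h : π (χ (rel i) - 1) = 0 by
      rw [map_sub, map_one, sub_eq_zero] at h
      exact Units.ext h
    rw [← hΛFι]
    -- At infinite depth the relator is already trivial in the truncation, so it needs no generator
    -- in `relIdeal w`.
    by_cases hi : depth p (rel i) = ⊤
    · obtain ⟨f, hf, hfe⟩ := exists_mem_ideal_of_mem_augIdeal_pow hN1 hΛF
        (iota_sub_one_mem_pow_of_depth_eq_top (p := p) hi (N + 1))
      rw [← hfe, hπ, Ideal.Quotient.eq_zero_iff_mem]
      exact Submodule.mem_sup_right hf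
    · rw [← hwχ ⟨i, hi⟩, hπ, Ideal.Quotient.eq_zero_iff_mem]
      exact Submodule.mem_sup_left (mem_relIdeal w _)
  have hle : χ.ker ≤ χQ.ker := fun g hg => by
    rw [MonoidHom.mem_ker] at hg ⊢
    rw [MonoidHom.comp_apply, hg, map_one]
  have hopen : IsOpen (χQ.ker : Set F) := Subgroup.isOpen_mono hle hχo
  -- An open subgroup is closed, so killing the relators kills the closure of their normal closure.
  have hkerle : φ.toMonoidHom.ker ≤ χQ.ker := by
    rw [hker]
    refine Subgroup.topologicalClosure_minimal _ (Subgroup.normalClosure_le_normal ?_)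
      (Subgroup.isClosed_of_isOpen _ hopen)
    rintro _ ⟨i, rfl⟩
    exact hrel i
  obtain ⟨χ', U, hU, hχ'⟩ := exists_descend hφ hopen hkerle
  let Λ : iwasawaAlgebra p G →ₐ[ZMod p] WordAlgebra (ZMod p) d ⧸ Q :=
    iwasawaLift ((Units.coeHom _).comp χ') U fun g hg => congrArg Units.val (hU g hg)
  have hΛι (g : F) : Λ (iota p (φ g)) = π (χ g) := by
    refine (iwasawaLift_iota _ _).trans ?_
    rw [MonoidHom.comp_apply, hχ']
    rfl
  have hπε (y : Truncation p d N) : quotientAug Q hQ (π y) = truncationAug p d N y := by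
    obtain ⟨f, rfl⟩ := Ideal.Quotient.mk_surjective y
    rfl
  have hΛ (x) : quotientAug Q hQ (Λ x) = augmentation p G x := by
    refine iwasawaLift_augmentation _ (fun g => ?_) x
    obtain ⟨g, rfl⟩ := hφ g
    rw [MonoidHom.comp_apply, hχ']
    exact (hπε _).trans (hχε g)
  -- The composite of `μ` with `Λ` is the quotient map of the free algebra, which makes `Λ`
  -- surjective.
  let μ : WordAlgebra (ZMod p) d →ₐ[ZMod p] iwasawaAlgebra p G :=
    MonoidAlgebra.lift (ZMod p) _ _ (FreeMonoid.lift fun j => iota p (φ (σ j)) - 1)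
  have hμ (f) : Λ (μ f) = Ideal.Quotient.mk Q f := by
    have : Λ.comp μ = Ideal.Quotient.mkₐ (ZMod p) Q := by
      apply (MonoidAlgebra.lift (ZMod p) _ _).symm.injective
      refine FreeMonoid.hom_eq fun j => ?_
      change Λ (μ (X j)) = Ideal.Quotient.mk Q (X j)
      have : μ (X j) = iota p (φ (σ j)) - 1 := by simp [μ, X]
      rw [this, map_sub, map_one, hΛι, hχσ, hπ, map_add, map_one, add_sub_cancel_left]
    exact DFunLike.congr_fun this f
  let e := Submodule.Quotient.restrictScalarsEquiv (ZMod p) Q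
  have hzero : augPow p G (N + 1) ≤
      LinearMap.ker (e.symm.toLinearMap ∘ₗ (Λ.toLinearMap : _ →ₗ[ZMod p] _ ⧸ Q)) := by
    intro x hx
    obtain ⟨f, hf, hfx⟩ := exists_mem_ideal_of_mem_augIdeal_pow hQ hΛ hx
    have h0 : Λ x = 0 := by
      rw [← hfx, Ideal.Quotient.eq_zero_iff_mem]
      exact Submodule.mem_sup_right hf
    rw [LinearMap.mem_ker, LinearMap.comp_apply, AlgHom.toLinearMap_apply, h0, map_zero]
  have := finiteDimensional_quotient_augPow (p := p) (hF.closure_range_eq_top hG hφ) (N + 1)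
  refine LinearMap.finrank_le_finrank_of_surjective (f := (augPow p G (N + 1)).liftQ _ hzero)
    fun q => ?_
  obtain ⟨f, rfl⟩ := Submodule.mkQ_surjective _ q
  refine ⟨(augPow p G (N + 1)).mkQ (μ f), ?_⟩
  rw [Submodule.mkQ_apply, Submodule.liftQ_apply, LinearMap.comp_apply, AlgHom.toLinearMap_apply,
    hμ]
  rfl

omit [Fact p.Prime] [IsTopologicalGroup F] in
theorem eval_golodShafarevich (d : ℕ) (rel : Fin r → F) (t : ℝ) :
    (golodShafarevich p d rel).eval t =
      1 - d * t + ∑ i : {i // depth p (rel i) ≠ ⊤}, t ^ (depth p (rel i)).toNat := by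
  classical
  have (i : Fin r) : (if depth p (rel i) = ⊤ then (0 : Polynomial ℝ)
      else Polynomial.X ^ (depth p (rel i)).toNat).eval t =
      if depth p (rel i) ≠ ⊤ then t ^ (depth p (rel i)).toNat else 0 := by
    split_ifs <;> simp_all
  simp only [golodShafarevich, Polynomial.eval_add, Polynomial.eval_sub, Polynomial.eval_one,
    Polynomial.eval_mul, Polynomial.eval_C, Polynomial.eval_X, Polynomial.eval_finsetSum, this]
  rw [← Finset.sum_filter, Finset.sum_subtype (p := fun i => depth p (rel i) ≠ ⊤) _ (by simp)]

end Presentation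

end ProP

theorem proposition2p4 (p : ℕ) [Fact p.Prime]
    {G : Type*} [Group G] [TopologicalSpace G] [IsTopologicalGroup G] (hG : ProP.IsProP p G)
    {F : Type*} [Group F] [TopologicalSpace F] [IsTopologicalGroup F]
    {d r : ℕ} (σ : Fin d → F) (rel : Fin r → F) (φ : F →ₜ* G)
    (hφ : ProP.IsMinimalPresentation p σ rel φ)
    (t₀ : ℝ) (ht₀ : t₀ ∈ Set.Ioo (0 : ℝ) 1)
    (hneg : (ProP.golodShafarevich p d rel).eval t₀ < 0) :
    ENNReal.ofReal (1 / t₀) ≤ ProP.rho p G := by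
  classical
  have := hG.compactSpace
  refine ProP.ofReal_one_div_le_limsup (d := d) ht₀.1 ht₀.2 fun N hN => ?_
  -- The truncation that kills words of length greater than N controls Ω(G) modulo the power N + 1.
  obtain ⟨N, rfl⟩ := Nat.exists_eq_add_of_le' hN
  obtain ⟨w, hw, hdim⟩ := ProP.exists_relators_truncDim_le hφ.isFreeProP hG hφ.surjective
    hφ.ker_eq N
  rw [ProP.finrank_quotient_augPow (hφ.isFreeProP.closure_range_eq_top hG hφ.surjective)] at hdim
  rw [ProP.eval_golodShafarevich] at hneg
  have hrec := ProP.WordAlgebra.golodShafarevich_recursion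
    (fun i : {i // ProP.depth p (rel i) ≠ ⊤} => ProP.one_le_toNat_depth i.2) hw
  have hpos := ht₀.1
  calc (1 : ℝ) ≤ d * t₀ ^ (N + 1) * ProP.WordAlgebra.truncDim w (N + 1) :=
        ProP.one_le_mul_of_recursion _ _ d hpos (ProP.WordAlgebra.truncDim_zero w) hrec hneg.le hN
    _ ≤ _ := by gcongr; exact_mod_cast hdim
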